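/- Let $\mathrm{FIN}$ be the set of nonempty finite subsets of $\mathbb N$, and write $s<t$ for $\max s<\min t$. Let $\mathrm{FIN}^\infty$ be the set of infinite block sequences $A=(s_0<s_1<\cdots)$ in $\mathrm{FIN}$, and $\mathrm{FIN}^{<\infty}$ the set of finite block sequences (including $\emptyset$); $|a|$ is the length of $a$ and $r_n(A)$ the sequence of the first $n$ blocks of $A$. Sequences are identified with their sets of blocks. Let $[A]=FU(A)$ be the set of all unions of finitely many (at least one) blocks of $A$, and put - $A\le B$ iff every block of $A$ is in $[B]$; $A\le^* B$ iff all but finitely many blocks of $A$ are in $[B]$; for finite $a,b$, $a\le_{\rm fin}b$ iff every block of $a$ is a union of (at least one) blocks of $b$; - $\mathrm{FIN}^{<\infty}\restriction A=\{a\in \mathrm{FIN}^{<\infty}: a\subseteq[A]\}$, and for such $a$, $\operatorname{depth}_A(a)=\min\{n: a\le_{\rm fin} r_n(A)\}$; - $[a,A]=\{B\in\mathrm{FIN}^\infty: B\le A,\ a=r_n(B)\text{ for some }n\}$, $[n,A]=[r_n(A),A]$, and $r_m[a,B]=\{r_m(C):C\in[a,B]\}$; - $B/b$ is the sequence of those blocks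 of $B$ that lie after all blocks of $b$. A family $\mathcal H\subseteq\mathrm{FIN}^\infty$ is a *coideal* if (a) $A\in\mathcal H$ and $A\triangle B$ finite imply $B\in\mathcal H$; (b) $A\in\mathcal H$ and $A\le B$ imply $B\in\mathcal H$; (c) for all $A\in\mathcal H$ and $a\in\mathrm{FIN}^{<\infty}\restriction A$: $[a,B]\ne\emptyset$ for every $B\in[\operatorname{depth}_A(a),A]\cap\mathcal H$; and if $B\in\mathcal H$, $B\le A$ and $[a,B]\neq\emptyset$, then there is $A'\in[\operatorname{depth}_A(a),A]\cap\mathcal H$ with $\emptyset\ne[a,A']\subseteq[a,B]$; (d) for all $A\in\mathcal H$, $a\in\mathrm{FIN}^{<\infty}\restriction A$ and every set $\mathcal O$ of finite block sequences of length $|a|+1$ there is $B\in[\operatorname{depth}_A(a),A]\cap\mathcal H$ with $r_{|a|+1}[a,B]\subseteq\mathcal O$ or $r_{|a|+1}[a,B]\cap\mathcal O=\emptyset$. A coideal $\mathcal H$ is *selective* if, whenever $A\in\mathcal H$, $[a,A]\neq\emptyset$, and $A_0\ge A_1\ge\cdots$ are members of $\mathcal H$ with $A_n\le A$ and $[a,A_n]\ne\emptyset$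 for all $n$, there is $B\in\mathcal H\cap[a,A]$ that diagonalizes $(A_n)$ within $A$, i.e. $B/b\le A_{\operatorname{depth}_A(b)}$ for every $b\in\mathrm{FIN}^{<\infty}\restriction B$. A family $\mathcal H\subseteq \mathrm{FIN}^\infty$ is *Matet-adequate* if it satisfies (a) and (b), $(\mathcal H,\le^*)$ is $\sigma$-closed (for every sequence $A_0\ge^*A_1\ge^*\cdots$ in $\mathcal H$ there is $B\in\mathcal H$ with $B\le^*A_n$ for all $n$), and it has the Hindman property: if $A\in\mathcal H$ and $FU(A)$ is partitioned into two pieces, there is $B\in\mathcal H$ with $B\le A$ such that $FU(B)$ is contained in one piece. **Theorem.** Every Matet-adequate family is a selective coideal of $\mathrm{FIN}^\infty$, and conversely. That is, for every $\mathcal H\subseteq\mathrm{FIN}^\infty$, $\mathcal H$ is Matet-adequate if and only if $\mathcal H$ is a selective coideal. -/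

import Mathlib

namespace BlockSeq

/-- `FIN`: the nonempty finite sets of natural numbers. -/
abbrev FIN : Type := {s : Finset ℕ // s.Nonempty}

/-- `s < t` in the block order: `max s < min t`. -/
def Precedes (s t : FIN) : Prop := s.1.max' s.2 < t.1.min' t.2

/-- `FIN^∞`: infinite block sequences of elements of `FIN`. -/
@[ext]
structure FINInf where
  block : ℕ → FIN
  precedes_succ : ∀ i, Precedes (block i) (block (i + 1))

/-- `FIN^{<∞}`: finite block sequences of elements of `FIN` (the empty one included). -/
@[ext]
structure FINFin where
  list : List FIN
  pairwise : list.Pairwise Precedes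

theorem Precedes.trans {s t u : FIN} (h : Precedes s t) (h' : Precedes t u) : Precedes s u :=
  lt_trans (lt_of_lt_of_le h (t.1.min'_le _ (t.1.max'_mem t.2))) h'

theorem FINInf.precedes_of_lt (A : FINInf) {i j : ℕ} (h : i < j) :
    Precedes (A.block i) (A.block j) := by
  induction j, h using Nat.le_induction with
  | base => exact A.precedes_succ i
  | succ j _ ih => exact ih.trans (A.precedes_succ j)

/-- The set of blocks of an infinite block sequence. -/
def FINInf.blocks (A : FINInf) : Set FIN := Set.range A.block

/-- The set of blocks of a finite block sequence. -/
def FINFin.blocks (a : FINFin) : Set FIN := {s | s ∈ a.list}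

/-- The length `|a|`. -/
def FINFin.length (a : FINFin) : ℕ := a.list.length

/-- `FU(S)`: all unions of finitely many (at least one) members of `S`. For the set of blocks of
`A ∈ FIN^∞` this is the subsemigroup `[A]` generated by `A`. -/
def FU (S : Set FIN) : Set FIN :=
  {t | ∃ F : Finset FIN, F.Nonempty ∧ (∀ s ∈ F, s ∈ S) ∧ t.1 = F.biUnion Subtype.val}

/-- `A ≤ B`: `A` is a condensation of `B`. -/
instance : LE FINInf := ⟨fun A B => A.blocks ⊆ FU B.blocks⟩

/-- `A ≤* B`: all but finitely many blocks of `A` belong to `[B]`. -/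
def AlmostLE (A B : FINInf) : Prop := (A.blocks \ FU B.blocks).Finite

/-- The approximation `r_n(A)`: the first `n` blocks of `A`. -/
def approx (n : ℕ) (A : FINInf) : FINFin where
  list := (List.range n).map A.block
  pairwise := by
    rw [List.pairwise_map]
    exact List.pairwise_lt_range.imp fun h => A.precedes_of_lt h

/-- The neighbourhood `[a, A]`. -/
def nbhd (a : FINFin) (A : FINInf) : Set FINInf := {B | (∃ n, a = approx n B) ∧ B ≤ A}

/-- `FIN^{<∞} ↾ A`: finite block sequences all of whose blocks belong to `[A]`. -/
def finBelow (A : FINInf) : Set FINFin := {a | a.blocks ⊆ FU A.blocks}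

/-- `a ≤_fin b`: every block of `a` is a finite union of blocks of `b`. -/
def LEFin (a b : FINFin) : Prop := a.blocks ⊆ FU b.blocks

/-- `depth_A(a) = min {n : a ≤_fin r_n(A)}`, meaningful for `a ∈ FIN^{<∞} ↾ A`. -/
noncomputable def depth (A : FINInf) (a : FINFin) : ℕ := sInf {n | LEFin a (approx n A)}

/-- The blocks of `B / b`: those blocks of `B` that lie entirely after `b`. -/
def blocksAfter (B : FINInf) (b : FINFin) : Set FIN :=
  {s | s ∈ B.blocks ∧ ∀ t ∈ b.blocks, Precedes t s}

/-- `H` is closed under finite changes. -/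
def ClosedUnderFiniteChanges (H : Set FINInf) : Prop :=
  ∀ A B : FINInf, A ∈ H → (symmDiff A.blocks B.blocks).Finite → B ∈ H

/-- `H` is closed upwards with respect to condensation. -/
def ClosedUpwards (H : Set FINInf) : Prop :=
  ∀ A B : FINInf, A ∈ H → A ≤ B → B ∈ H

/-- Coideals of `FIN^∞`. -/
structure IsCoideal (H : Set FINInf) : Prop where
  finite_changes : ClosedUnderFiniteChanges H
  upwards : ClosedUpwards H
  /-- A3 mod `H`, first part. -/
  amalgamation_nonempty : ∀ A ∈ H, ∀ a ∈ finBelow A,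
    ∀ B ∈ nbhd (approx (depth A a) A) A ∩ H, (nbhd a B).Nonempty
  /-- A3 mod `H`, second part. -/
  amalgamation_subset : ∀ A ∈ H, ∀ a ∈ finBelow A,
    ∀ B ∈ H, B ≤ A → (nbhd a B).Nonempty →
      ∃ A' ∈ nbhd (approx (depth A a) A) A ∩ H, (nbhd a A').Nonempty ∧ nbhd a A' ⊆ nbhd a B
  /-- A4 mod `H`. -/
  pigeonhole : ∀ A ∈ H, ∀ a ∈ finBelow A,
    ∀ O : Set FINFin, (∀ o ∈ O, o.length = a.length + 1) →
      ∃ B ∈ nbhd (approx (depth A a) A) A ∩ H,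
        approx (a.length + 1) '' nbhd a B ⊆ O ∨ approx (a.length + 1) '' nbhd a B ∩ O = ∅

/-- `B` diagonalizes the sequence `𝒜` within `A`: for every `b ∈ FIN^{<∞} ↾ B` with
`depth_A(b) = n`, one has `B / b ≤ 𝒜 n`. Equivalently, for every `C ∈ [b, B]` the part of `C`
after `b` is a condensation of `𝒜 n`. -/
def Diagonalizes (B : FINInf) (𝒜 : ℕ → FINInf) (A : FINInf) : Prop :=
  ∀ b ∈ finBelow B, b ∈ finBelow A → blocksAfter B b ⊆ FU (𝒜 (depth A b)).blocks

/-- Selective coideals of `FIN^∞`. -/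
structure IsSelectiveCoideal (H : Set FINInf) : Prop extends IsCoideal H where
  selective : ∀ (a : FINFin) (A : FINInf), A ∈ H → (nbhd a A).Nonempty →
    ∀ 𝒜 : ℕ → FINInf, (∀ n, 𝒜 n ∈ H ∧ 𝒜 n ≤ A) → (∀ n, 𝒜 (n + 1) ≤ 𝒜 n) →
      (∀ n, (nbhd a (𝒜 n)).Nonempty) →
        ∃ B ∈ H ∩ nbhd a A, Diagonalizes B 𝒜 A

/-- Matet-adequate families. -/
structure IsMatetAdequate (H : Set FINInf) : Prop where
  finite_changes : ClosedUnderFiniteChanges H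
  upwards : ClosedUpwards H
  /-- `(H, ≤*)` is σ-closed. -/
  sigma_closed : ∀ 𝒜 : ℕ → FINInf, (∀ n, 𝒜 n ∈ H) → (∀ n, AlmostLE (𝒜 (n + 1)) (𝒜 n)) →
    ∃ B ∈ H, ∀ n, AlmostLE B (𝒜 n)
  /-- The Hindman property. -/
  hindman : ∀ A ∈ H, ∀ P Q : Set FIN, P ∪ Q = FU A.blocks → Disjoint P Q →
    ∃ B ∈ H, B ≤ A ∧ (FU B.blocks ⊆ P ∨ FU B.blocks ⊆ Q)

end BlockSeq

/-!
Everything in the definition of a coideal becomes elementary once `[a, A] ≠ ∅` is recognised as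
`a ⊆ [A]` and one notices that a union of blocks of `r_d(A) ⌢ B`, `d = depth_A(a)`, lying after
`a` uses only blocks of `B`: otherwise it would contain a block `A_j`, `j < d`, lying after `a`, and
`a` would already have depth at most `j`. Thus A4 is the Hindman property for the colouring of `t`
by whether `a ⌢ t` belongs to `𝒪`, and conversely A4 at `a = ∅` is the Hindman property.

For selectivity, σ-closedness yields a pseudo-intersection `C` of the `A_n`. A union of blocks of
`C` is in `[A_n]` as soon as it starts after some `g(n)`, so it suffices to thin out `C` to a
sequence whose gaps grow faster than `g`. The Hindman property does this: colour `t` by the parity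
of the number of *short* gaps inside `t`. If `s < t` then the count for `s ∪ t` is the sum of the
two counts, plus one if the gap between `s` and `t` is short. Blocks far apart show that a
homogeneous colour can only be "even", and then no gap between two blocks can be short.

Conversely, the `n`-th tail of a diagonalization `B` of a decreasing sequence `(A_n)` condenses
`A_n`, because `depth_A(r_n(B)) ≥ n`; and a `≤*`-decreasing sequence becomes `≤`-decreasing after
removing finitely many blocks from each term.
-/

namespace BlockSeq

theorem precedes_iff {s t : FIN} : Precedes s t ↔ ∀ x ∈ s.1, ∀ y ∈ t.1, x < y := by
  simp only [Precedes, Finset.max'_lt_iff, Finset.lt_min'_iff]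
  exact forall₂_comm

theorem Precedes.mono {s s' t t' : FIN} (h : Precedes s t) (hs : s'.1 ⊆ s.1) (ht : t'.1 ⊆ t.1) :
    Precedes s' t' :=
  precedes_iff.2 fun x hx y hy => precedes_iff.1 h x (hs hx) y (ht hy)

theorem not_precedes_self (s : FIN) : ¬ Precedes s s := fun h =>
  have ⟨x, hx⟩ := s.2
  lt_irrefl x (precedes_iff.1 h x hx x hx)

theorem mem_FU {S : Set FIN} {t : FIN} :
    t ∈ FU S ↔ ∀ x ∈ t.1, ∃ s ∈ S, x ∈ s.1 ∧ s.1 ⊆ t.1 := by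
  constructor
  · rintro ⟨F, -, hFS, ht⟩ x hx
    obtain ⟨s, hs, hxs⟩ := Finset.mem_biUnion.1 (ht ▸ hx)
    exact ⟨s, hFS s hs, hxs, ht ▸ Finset.subset_biUnion_of_mem Subtype.val hs⟩
  · intro h
    choose f hfS hxf hft using h
    refine ⟨t.1.attach.image fun x => f x.1 x.2, t.2.attach.image _, ?_, ?_⟩
    · exact Finset.forall_mem_image.2 fun x _ => hfS x.1 x.2
    · rw [Finset.image_biUnion]
      refine subset_antisymm (fun x hx => ?_) (Finset.biUnion_subset.2 fun x _ => hft x.1 x.2)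
      exact Finset.mem_biUnion.2 ⟨⟨x, hx⟩, Finset.mem_attach _ _, hxf x hx⟩

theorem subset_FU (S : Set FIN) : S ⊆ FU S := fun s hs =>
  mem_FU.2 fun _ hx => ⟨s, hs, hx, subset_rfl⟩

theorem exists_subset_of_mem_FU {S : Set FIN} {t : FIN} (ht : t ∈ FU S) : ∃ s ∈ S, s.1 ⊆ t.1 :=
  have ⟨x, hx⟩ := t.2
  have ⟨s, hs, _, hst⟩ := mem_FU.1 ht x hx
  ⟨s, hs, hst⟩

theorem mem_FU_of_forall_subset {S T : Set FIN} {t : FIN} (ht : t ∈ FU S)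
    (h : ∀ s ∈ S, s.1 ⊆ t.1 → s ∈ FU T) : t ∈ FU T := by
  refine mem_FU.2 fun x hx => ?_
  obtain ⟨s, hs, hxs, hst⟩ := mem_FU.1 ht x hx
  obtain ⟨u, hu, hxu, hus⟩ := mem_FU.1 (h s hs hst) x hxs
  exact ⟨u, hu, hxu, hus.trans hst⟩

theorem FU_subset_FU {S T : Set FIN} (h : S ⊆ FU T) : FU S ⊆ FU T := fun _ ht =>
  mem_FU_of_forall_subset ht fun _ hs _ => h hs

theorem union_mem_FU {S : Set FIN} {s t : FIN} (hs : s ∈ FU S) (ht : t ∈ FU S) :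
    (⟨s.1 ∪ t.1, s.2.inl⟩ : FIN) ∈ FU S := by
  refine mem_FU.2 fun x hx => ?_
  rcases Finset.mem_union.1 hx with hx | hx
  · obtain ⟨u, hu, hxu, hus⟩ := mem_FU.1 hs x hx
    exact ⟨u, hu, hxu, hus.trans Finset.subset_union_left⟩
  · obtain ⟨u, hu, hxu, hut⟩ := mem_FU.1 ht x hx
    exact ⟨u, hu, hxu, hut.trans Finset.subset_union_right⟩

/-! ### Tails and approximations -/

instance : Preorder FINInf where
  le_refl A := subset_FU A.blocks
  le_trans _ _ _ h h' := h.trans (FU_subset_FU h')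

namespace FINInf

variable {A B : FINInf} {i j k x : ℕ}

theorem block_mem (A : FINInf) (i : ℕ) : A.block i ∈ A.blocks := ⟨i, rfl⟩

theorem precedes_block_iff (A : FINInf) : Precedes (A.block i) (A.block j) ↔ i < j := by
  refine ⟨fun h => ?_, A.precedes_of_lt⟩
  by_contra! hji
  rcases hji.lt_or_eq with hji | rfl
  · exact not_precedes_self _ (h.trans (A.precedes_of_lt hji))
  · exact not_precedes_self _ h

theorem block_injective (A : FINInf) : Function.Injective A.block :=
  Function.Injective.of_lt_imp_ne fun _ _ hij h =>
    not_precedes_self _ (h ▸ A.precedes_of_lt hij)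

theorem le_of_mem_block (A : FINInf) (hx : x ∈ (A.block i).1) : i ≤ x := by
  induction i generalizing x with
  | zero => exact Nat.zero_le x
  | succ i ih =>
    obtain ⟨y, hy⟩ := (A.block i).2
    exact (ih hy).trans_lt (precedes_iff.1 (A.precedes_succ i) y hy x hx)

theorem le_of_block_subset (hAB : A ≤ B) (h : (B.block j).1 ⊆ (A.block i).1) : i ≤ j := by
  induction i generalizing j with
  | zero => exact Nat.zero_le j
  | succ i ih =>
    obtain ⟨_, ⟨m, rfl⟩, hm⟩ := exists_subset_of_mem_FU (hAB (A.block_mem i))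
    have hmj : m < j := B.precedes_block_iff.1 ((A.precedes_succ i).mono hm h)
    exact (ih hm).trans_lt hmj

/-- The tail of `A` obtained by removing its first `k` blocks. -/
def drop (k : ℕ) (A : FINInf) : FINInf where
  block i := A.block (i + k)
  precedes_succ i := A.precedes_of_lt (Nat.add_lt_add_right i.lt_succ_self k)

theorem drop_drop (A : FINInf) (k l : ℕ) : (A.drop k).drop l = A.drop (k + l) := by
  ext1
  simp only [drop, Nat.add_assoc, Nat.add_comm l]

theorem drop_blocks (k : ℕ) (A : FINInf) : (A.drop k).blocks = A.block '' Set.Ici k :=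
  Set.range_add_eq_image_Ici

theorem block_mem_drop (A : FINInf) (hj : k ≤ j) : A.block j ∈ (A.drop k).blocks :=
  A.drop_blocks k ▸ Set.mem_image_of_mem _ hj

theorem drop_blocks_subset (k : ℕ) (A : FINInf) : (A.drop k).blocks ⊆ A.blocks :=
  A.drop_blocks k ▸ Set.image_subset_range _ _

theorem drop_le (k : ℕ) (A : FINInf) : A.drop k ≤ A :=
  (A.drop_blocks_subset k).trans (subset_FU _)

theorem drop_le_drop (hAB : A ≤ B) (k : ℕ) : A.drop k ≤ B.drop k := by
  rintro _ ⟨i, rfl⟩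
  refine mem_FU_of_forall_subset (hAB (A.block_mem _)) ?_
  rintro _ ⟨j, rfl⟩ hj
  have hkj : k ≤ j := (Nat.le_add_left k i).trans (le_of_block_subset hAB hj)
  exact subset_FU _ (B.block_mem_drop hkj)

end FINInf

section Approx

variable {A B : FINInf} {n : ℕ} {s : FIN}

theorem approx_blocks (n : ℕ) (A : FINInf) : (approx n A).blocks = A.block '' Set.Iio n := by
  ext s
  simp [approx, FINFin.blocks]

theorem block_mem_approx (A : FINInf) {j : ℕ} (hj : j < n) : A.block j ∈ (approx n A).blocks :=
  approx_blocks n A ▸ Set.mem_image_of_mem _ hj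

theorem approx_blocks_union_drop_blocks (n : ℕ) (A : FINInf) :
    (approx n A).blocks ∪ (A.drop n).blocks = A.blocks := by
  rw [approx_blocks, FINInf.drop_blocks, ← Set.image_union, Set.Iio_union_Ici, Set.image_univ]
  rfl

theorem approx_blocks_subset (n : ℕ) (A : FINInf) : (approx n A).blocks ⊆ A.blocks :=
  approx_blocks n A ▸ Set.image_subset_range _ _

theorem approx_mem_finBelow (hBA : B ≤ A) (n : ℕ) : approx n B ∈ finBelow A :=
  (approx_blocks_subset n B).trans hBA

theorem length_approx (n : ℕ) (A : FINInf) : (approx n A).length = n := by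
  simp [approx, FINFin.length]

theorem list_approx_succ (n : ℕ) (A : FINInf) :
    (approx (n + 1) A).list = (approx n A).list ++ [A.block n] := by
  simp [approx, List.range_succ]

theorem mem_FU_approx_of_precedes (hs : s ∈ FU A.blocks) (h : Precedes s (A.block n)) :
    s ∈ FU (approx n A).blocks := by
  refine mem_FU_of_forall_subset hs ?_
  rintro _ ⟨j, rfl⟩ hj
  have hjn : j < n := A.precedes_block_iff.1 (h.mono hj subset_rfl)
  exact subset_FU _ (block_mem_approx A hjn)

theorem leFin_approx_of_forall_precedes {a : FINFin} (ha : a ∈ finBelow A)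
    (h : ∀ s ∈ a.blocks, Precedes s (A.block n)) : LEFin a (approx n A) := fun s hs =>
  mem_FU_approx_of_precedes (ha hs) (h s hs)

end Approx

namespace FINFin

/-- The strict upper bound `max (⋃ a) + 1` of the elements of the blocks of `a`, with value `0` for
the empty sequence. -/
def bound (a : FINFin) : ℕ := a.list.toFinset.sup fun s => s.1.max' s.2 + 1

theorem bound_le_iff {a : FINFin} {N : ℕ} :
    a.bound ≤ N ↔ ∀ s ∈ a.blocks, ∀ x ∈ s.1, x < N := by
  simp only [bound, Finset.sup_le_iff, List.mem_toFinset, Nat.succ_le_iff, Finset.max'_lt_iff]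
  rfl

theorem lt_bound {a : FINFin} {s : FIN} (hs : s ∈ a.blocks) {x : ℕ} (hx : x ∈ s.1) :
    x < a.bound :=
  bound_le_iff.1 le_rfl s hs x hx

theorem finite_blocks (a : FINFin) : a.blocks.Finite := a.list.finite_toSet

end FINFin

theorem LEFin.bound_le {a b : FINFin} (hab : LEFin a b) : a.bound ≤ b.bound := by
  refine FINFin.bound_le_iff.2 fun s hs x hx => ?_
  obtain ⟨t, ht, hxt, -⟩ := mem_FU.1 (hab hs) x hx
  exact FINFin.lt_bound ht hxt

theorem bound_approx_succ (n : ℕ) (A : FINInf) :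
    (approx (n + 1) A).bound = (A.block n).1.max' (A.block n).2 + 1 := by
  refine le_antisymm (FINFin.bound_le_iff.2 fun s hs x hx => ?_) ?_
  · obtain ⟨j, hj, rfl⟩ := approx_blocks (n + 1) A ▸ hs
    rcases (Nat.lt_succ_iff.1 hj).lt_or_eq with hjn | rfl
    · exact Nat.lt_succ_of_lt
        (precedes_iff.1 (A.precedes_of_lt hjn) x hx _ (Finset.max'_mem _ _))
    · exact Nat.lt_succ_of_le (Finset.le_max' _ x hx)
  · exact FINFin.lt_bound (block_mem_approx A n.lt_succ_self) (Finset.max'_mem _ _)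

theorem mem_FU_drop_of_bound_le {A : FINInf} {k : ℕ} {s : FIN} (hs : s ∈ FU A.blocks)
    (h : ∀ x ∈ s.1, (approx k A).bound ≤ x) : s ∈ FU (A.drop k).blocks := by
  refine mem_FU_of_forall_subset hs ?_
  rintro _ ⟨j, rfl⟩ hj
  have hkj : k ≤ j := by
    by_contra! hjk
    obtain ⟨x, hx⟩ := (A.block j).2
    exact (FINFin.lt_bound (block_mem_approx A hjk) hx).not_ge (h x (hj hx))
  exact subset_FU _ (A.block_mem_drop hkj)

theorem precedes_block_of_bound_le {a : FINFin} {s : FIN} (hs : s ∈ a.blocks) {n : ℕ}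
    (hn : a.bound ≤ n) (A : FINInf) : Precedes s (A.block n) :=
  precedes_iff.2 fun _ hx _ hy =>
    (FINFin.lt_bound hs hx).trans_le (hn.trans (A.le_of_mem_block hy))

/-! ### Depth -/

section Depth

variable {A B : FINInf} {a : FINFin}

theorem LEFin.depth_le {n : ℕ} (h : LEFin a (approx n A)) : depth A a ≤ n :=
  Nat.sInf_le h

theorem leFin_approx_bound (ha : a ∈ finBelow A) : LEFin a (approx a.bound A) :=
  leFin_approx_of_forall_precedes ha fun _ hs => precedes_block_of_bound_le hs le_rfl A

theorem depth_le_bound (ha : a ∈ finBelow A) : depth A a ≤ a.bound :=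
  (leFin_approx_bound ha).depth_le

theorem leFin_approx_depth (ha : a ∈ finBelow A) : LEFin a (approx (depth A a) A) :=
  Nat.sInf_mem (s := {n | LEFin a (approx n A)}) ⟨a.bound, leFin_approx_bound ha⟩

theorem le_depth_approx (hBA : B ≤ A) (n : ℕ) : n ≤ depth A (approx n B) := by
  rcases n with _ | n
  · exact Nat.zero_le _
  obtain ⟨s, hs, hsn⟩ := exists_subset_of_mem_FU
    (leFin_approx_depth (approx_mem_finBelow hBA (n + 1)) (block_mem_approx B n.lt_succ_self))
  obtain ⟨j, hj, rfl⟩ := approx_blocks _ A ▸ hs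
  exact (FINInf.le_of_block_subset hBA hsn).trans_lt hj

end Depth

/-! ### Concatenation and neighbourhoods -/

namespace FINFin

variable {a : FINFin} {A B : FINInf}

/-- The concatenation of `a` with a tail of `A`. The tail starts at the index `a.bound`, which makes
the concatenation a block sequence for all `a` and `A` because every element of the `i`-th block of
`A` is at least `i`. -/
def append (a : FINFin) (A : FINInf) : FINInf where
  block i := if hi : i < a.length then a.list[i] else (A.drop a.bound).block (i - a.length)
  precedes_succ i := by
    rcases lt_trichotomy (i + 1) a.length with h | h | h
    · rw [dif_pos h, dif_pos (Nat.lt_of_succ_lt h)]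
      exact List.pairwise_iff_getElem.1 a.pairwise _ _ _ _ i.lt_succ_self
    · rw [dif_neg h.not_lt, dif_pos (by omega)]
      exact precedes_block_of_bound_le (List.getElem_mem _) (Nat.le_add_left _ _) A
    · rw [dif_neg (by omega), dif_neg (by omega)]
      exact (A.drop a.bound).precedes_of_lt (by omega)

theorem append_block_of_lt (A : FINInf) {i : ℕ} (hi : i < a.length) :
    (a.append A).block i = a.list[i]'hi :=
  dif_pos hi

theorem append_block_length_add (a : FINFin) (A : FINInf) (i : ℕ) :
    (a.append A).block (a.length + i) = (A.drop a.bound).block i := by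
  simp [append, FINInf.drop]

theorem append_blocks (a : FINFin) (A : FINInf) :
    (a.append A).blocks = a.blocks ∪ (A.drop a.bound).blocks := by
  ext s
  constructor
  · rintro ⟨i, rfl⟩
    rcases lt_or_ge i a.length with hi | hi
    · rw [append_block_of_lt A hi]
      exact Or.inl (List.getElem_mem hi)
    · obtain ⟨i, rfl⟩ := Nat.exists_eq_add_of_le hi
      exact Or.inr ⟨i, (append_block_length_add a A i).symm⟩
  · rintro (hs | ⟨i, rfl⟩)
    · obtain ⟨i, hi, rfl⟩ := List.getElem_of_mem hs
      exact ⟨i, append_block_of_lt A hi⟩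
    · exact ⟨a.length + i, append_block_length_add a A i⟩

theorem approx_length_append (a : FINFin) (A : FINInf) : approx a.length (a.append A) = a := by
  ext1
  refine List.ext_getElem (length_approx _ _) fun i _ hi => ?_
  simp only [approx, List.getElem_map, List.getElem_range]
  exact append_block_of_lt A hi

theorem append_le (ha : a ∈ finBelow B) (hAB : A ≤ B) : a.append A ≤ B := by
  refine (append_blocks a A).trans_subset (Set.union_subset ha ?_)
  exact (A.drop_blocks_subset _).trans hAB

end FINFin

section Neighbourhood

variable {a : FINFin} {A B C : FINInf} {i : ℕ}

theorem mem_nbhd_iff : C ∈ nbhd a A ↔ approx a.length C = a ∧ C ≤ A := by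
  refine and_congr_left fun _ => ⟨?_, fun h => ⟨_, h.symm⟩⟩
  rintro ⟨n, rfl⟩
  rw [length_approx]

theorem append_mem_nbhd (ha : a ∈ finBelow B) (hAB : A ≤ B) : a.append A ∈ nbhd a B :=
  mem_nbhd_iff.2 ⟨a.approx_length_append A, FINFin.append_le ha hAB⟩

theorem nbhd_nonempty_iff : (nbhd a A).Nonempty ↔ a ∈ finBelow A := by
  refine ⟨?_, fun ha => ⟨_, append_mem_nbhd ha le_rfl⟩⟩
  rintro ⟨B, ⟨n, rfl⟩, hBA⟩
  exact approx_mem_finBelow hBA n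

theorem block_mem_of_mem_nbhd (hC : C ∈ nbhd a A) (hi : i < a.length) :
    C.block i ∈ a.blocks := by
  rw [← (mem_nbhd_iff.1 hC).1]
  exact block_mem_approx C hi

theorem precedes_block_of_mem_nbhd (hC : C ∈ nbhd a A) (hi : a.length ≤ i) :
    ∀ s ∈ a.blocks, Precedes s (C.block i) := by
  rw [← (mem_nbhd_iff.1 hC).1, approx_blocks]
  exact Set.forall_mem_image.2 fun j hj => C.precedes_of_lt (hj.trans_le hi)

theorem list_approx_succ_of_mem_nbhd (hC : C ∈ nbhd a A) :
    (approx (a.length + 1) C).list = a.list ++ [C.block a.length] := by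
  rw [list_approx_succ, (mem_nbhd_iff.1 hC).1]

theorem mem_finBelow_of_mem_nbhd_depth (ha : a ∈ finBelow A)
    (hB : B ∈ nbhd (approx (depth A a) A) A) : a ∈ finBelow B := by
  refine (leFin_approx_depth ha).trans (FU_subset_FU ?_)
  exact nbhd_nonempty_iff.1 ⟨B, mem_nbhd_iff.2 ⟨(mem_nbhd_iff.1 hB).1, le_rfl⟩⟩

theorem block_mem_FU_of_mem_nbhd_append (ha : a ∈ finBelow A)
    (hC : C ∈ nbhd a ((approx (depth A a) A).append B)) (hi : a.length ≤ i) :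
    C.block i ∈ FU B.blocks := by
  have haC := precedes_block_of_mem_nbhd hC hi
  refine mem_FU_of_forall_subset (hC.2 (C.block_mem i)) fun s hs hsC => ?_
  rcases FINFin.append_blocks _ B ▸ hs with hs | hs
  · exfalso
    obtain ⟨j, hj, rfl⟩ := approx_blocks _ A ▸ hs
    have hle : LEFin a (approx j A) := leFin_approx_of_forall_precedes ha fun t ht =>
      (haC t ht).mono subset_rfl hsC
    exact hle.depth_le.not_gt hj
  · exact FINInf.drop_le _ B hs

end Neighbourhood

/-! ### Finite changes and almost condensation -/

namespace ClosedUnderFiniteChanges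

variable {H : Set FINInf} {A : FINInf}

theorem drop_mem (hH : ClosedUnderFiniteChanges H) (hA : A ∈ H) (k : ℕ) : A.drop k ∈ H := by
  refine hH A _ hA ((approx k A).finite_blocks.subset ?_)
  rw [← approx_blocks_union_drop_blocks k A, Set.symmDiff_def, Set.union_sdiff_right,
    Set.sdiff_eq_empty.2 Set.subset_union_right, Set.union_empty]
  exact Set.sdiff_subset

theorem append_mem (hH : ClosedUnderFiniteChanges H) (hA : A ∈ H) (a : FINFin) :
    a.append A ∈ H := by
  refine hH _ _ (hH.drop_mem hA a.bound) (a.finite_blocks.subset ?_)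
  rw [a.append_blocks, Set.symmDiff_def, Set.sdiff_eq_empty.2 Set.subset_union_right,
    Set.empty_union, Set.union_sdiff_right]
  exact Set.sdiff_subset

end ClosedUnderFiniteChanges

theorem almostLE_iff_exists_drop_le {A B : FINInf} : AlmostLE A B ↔ ∃ k, A.drop k ≤ B := by
  constructor
  · intro h
    obtain ⟨k, hk⟩ := (h.preimage A.block_injective.injOn).bddAbove
    refine ⟨k + 1, ?_⟩
    rintro _ ⟨i, rfl⟩
    by_contra hi
    have hik : i + (k + 1) ≤ k := hk ⟨A.block_mem _, hi⟩
    omega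
  · rintro ⟨k, hk⟩
    refine (approx k A).finite_blocks.subset ?_
    rintro s ⟨hsA, hsB⟩
    rw [← approx_blocks_union_drop_blocks k A] at hsA
    exact hsA.resolve_right fun hs => hsB (hk hs)

theorem AlmostLE.exists_forall_mem_FU {A B : FINInf} (h : AlmostLE A B) :
    ∃ N, ∀ s ∈ FU A.blocks, (∀ x ∈ s.1, N ≤ x) → s ∈ FU B.blocks := by
  obtain ⟨k, hk⟩ := almostLE_iff_exists_drop_le.1 h
  exact ⟨_, fun s hs hN => FU_subset_FU hk (mem_FU_drop_of_bound_le hs hN)⟩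

theorem exists_antitone_drop {𝒜 : ℕ → FINInf} (h : ∀ n, AlmostLE (𝒜 (n + 1)) (𝒜 n)) :
    ∃ k : ℕ → ℕ, Antitone fun n => (𝒜 n).drop (k n) := by
  choose l hl using fun n => almostLE_iff_exists_drop_le.1 (h n)
  refine ⟨fun n => ∑ i ∈ Finset.range n, l i, antitone_nat_of_succ_le fun n => ?_⟩
  beta_reduce
  rw [Finset.sum_range_succ, add_comm, ← FINInf.drop_drop]
  exact FINInf.drop_le_drop (hl n) _

/-! ### Short gaps -/

section ShortGaps

variable {F : ℕ → ℕ} {s t : FIN}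

/-- The gap between `s` and `t` is *long* with respect to `F`: `F (max s) < min t`. -/
def PrecedesBy (F : ℕ → ℕ) (s t : FIN) : Prop := F (s.1.max' s.2) < t.1.min' t.2

/-- The left end points of the short gaps of `s` with respect to `F`: those `x ∈ s` for which `s`
has an element in the interval `(x, F x]`. -/
def shortGaps (F : ℕ → ℕ) (s : Finset ℕ) : Finset ℕ := {x ∈ s | ∃ y ∈ s, x < y ∧ y ≤ F x}

theorem mem_shortGaps {s : Finset ℕ} {x : ℕ} :
    x ∈ shortGaps F s ↔ x ∈ s ∧ ∃ y ∈ s, x < y ∧ y ≤ F x :=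
  Finset.mem_filter

theorem shortGaps_subset (F : ℕ → ℕ) (s : Finset ℕ) : shortGaps F s ⊆ s :=
  Finset.filter_subset _ _

theorem max'_notMem_shortGaps (F : ℕ → ℕ) (s : FIN) : s.1.max' s.2 ∉ shortGaps F s.1 := fun h =>
  have ⟨_, y, hy, hlt, _⟩ := mem_shortGaps.1 h
  (s.1.le_max' y hy).not_gt hlt

theorem mem_shortGaps_union (hst : Precedes s t) {x : ℕ} :
    x ∈ shortGaps F (s.1 ∪ t.1) ↔
      x ∈ shortGaps F s.1 ∨ x ∈ shortGaps F t.1 ∨ x = s.1.max' s.2 ∧ ¬ PrecedesBy F s t := by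
  have hlt := precedes_iff.1 hst
  simp only [mem_shortGaps, Finset.mem_union, PrecedesBy, not_lt]
  constructor
  · rintro ⟨hx | hx, y, hy | hy, hxy, hyF⟩
    · exact Or.inl ⟨hx, y, hy, hxy, hyF⟩
    · rcases (s.1.le_max' x hx).lt_or_eq with hmax | hmax
      · have hmaxy := hlt _ (s.1.max'_mem s.2) y hy
        exact Or.inl ⟨hx, _, s.1.max'_mem s.2, hmax, hmaxy.le.trans hyF⟩
      · exact Or.inr (Or.inr ⟨hmax, (t.1.min'_le y hy).trans (hmax ▸ hyF)⟩)
    · exact absurd (hlt y hy x hx) hxy.not_gt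
    · exact Or.inr (Or.inl ⟨hx, y, hy, hxy, hyF⟩)
  · rintro (⟨hx, y, hy, hxy⟩ | ⟨hx, y, hy, hxy⟩ | ⟨rfl, hF⟩)
    · exact ⟨Or.inl hx, y, Or.inl hy, hxy⟩
    · exact ⟨Or.inr hx, y, Or.inr hy, hxy⟩
    · exact ⟨Or.inl (s.1.max'_mem s.2), _, Or.inr (t.1.min'_mem t.2), hst, hF⟩

theorem Precedes.disjoint (hst : Precedes s t) : Disjoint s.1 t.1 :=
  Finset.disjoint_left.2 fun x hs ht => lt_irrefl x (precedes_iff.1 hst x hs x ht)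

theorem disjoint_shortGaps (hst : Precedes s t) :
    Disjoint (shortGaps F s.1) (shortGaps F t.1) :=
  hst.disjoint.mono (shortGaps_subset F s.1) (shortGaps_subset F t.1)

theorem card_shortGaps_union_of_precedesBy (hst : Precedes s t) (hF : PrecedesBy F s t) :
    (shortGaps F (s.1 ∪ t.1)).card = (shortGaps F s.1).card + (shortGaps F t.1).card := by
  rw [← Finset.card_union_of_disjoint (disjoint_shortGaps hst)]
  congr 1
  ext x
  simp only [mem_shortGaps_union hst, hF, not_true_eq_false, and_false, or_false, Finset.mem_union]

theorem card_shortGaps_union_of_not_precedesBy (hst : Precedes s t) (hF : ¬ PrecedesBy F s t) :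
    (shortGaps F (s.1 ∪ t.1)).card = (shortGaps F s.1).card + (shortGaps F t.1).card + 1 := by
  have hmax : s.1.max' s.2 ∉ shortGaps F s.1 ∪ shortGaps F t.1 := by
    rw [Finset.notMem_union]
    refine ⟨max'_notMem_shortGaps F s, fun h => ?_⟩
    exact Finset.disjoint_left.1 hst.disjoint (s.1.max'_mem s.2) (shortGaps_subset F t.1 h)
  rw [← Finset.card_union_of_disjoint (disjoint_shortGaps hst), ← Finset.card_insert_of_notMem hmax]
  congr 1
  ext x
  simp only [mem_shortGaps_union hst, hF, not_false_eq_true, and_true, Finset.mem_insert,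
    Finset.mem_union]
  tauto

theorem FINInf.precedesBy_block (B : FINInf) (F : ℕ → ℕ) (s : FIN) :
    PrecedesBy F s (B.block (F (s.1.max' s.2) + 1)) :=
  B.le_of_mem_block (Finset.min'_mem _ _)

theorem precedesBy_block_of_forall_even {B : FINInf}
    (h : ∀ t ∈ FU B.blocks, Even (shortGaps F t.1).card) {i j : ℕ} (hij : i < j) :
    PrecedesBy F (B.block i) (B.block j) := by
  by_contra hshort
  have hi := subset_FU _ (B.block_mem i)
  have hj := subset_FU _ (B.block_mem j)
  have hunion := h _ (union_mem_FU hi hj)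
  rw [card_shortGaps_union_of_not_precedesBy (B.precedes_of_lt hij) hshort] at hunion
  exact Nat.not_even_iff_odd.2 ((h _ hi).add (h _ hj)).add_one hunion

theorem exists_even_card_shortGaps (F : ℕ → ℕ) (B : FINInf) :
    ∃ t ∈ FU B.blocks, Even (shortGaps F t.1).card := by
  by_contra! hodd
  simp only [Nat.not_even_iff_odd] at hodd
  set j := F ((B.block 0).1.max' (B.block 0).2) + 1
  have hi := subset_FU _ (B.block_mem 0)
  have hj := subset_FU _ (B.block_mem j)
  have hunion := hodd _ (union_mem_FU hi hj)
  rw [card_shortGaps_union_of_precedesBy (B.precedes_of_lt (Nat.succ_pos _))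
    (B.precedesBy_block F _)] at hunion
  exact Nat.not_even_iff_odd.2 hunion ((hodd _ hi).add_odd (hodd _ hj))

end ShortGaps

/-! ### Diagonalizations -/

section Diagonalization

variable {A B : FINInf} {𝒜 : ℕ → FINInf}

theorem diagonalizes_of_forall_block_mem (h𝒜 : Antitone 𝒜)
    (h : ∀ n, B.block n ∈ FU (𝒜 (approx n B).bound).blocks) : Diagonalizes B 𝒜 A := by
  rintro b hbB hbA _ ⟨⟨n, rfl⟩, hbn⟩
  have hdepth : depth A b ≤ (approx n B).bound :=
    (depth_le_bound hbA).trans (leFin_approx_of_forall_precedes hbB hbn).bound_le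
  exact FU_subset_FU (h𝒜 hdepth) (h n)

theorem Diagonalizes.drop_le (h : Diagonalizes B 𝒜 A) (hBA : B ≤ A) (h𝒜 : Antitone 𝒜) (n : ℕ) :
    B.drop n ≤ 𝒜 n := by
  rintro _ ⟨i, rfl⟩
  have hafter : B.block (i + n) ∈ blocksAfter B (approx n B) := by
    refine ⟨B.block_mem _, approx_blocks n B ▸ Set.forall_mem_image.2 fun j hj => ?_⟩
    exact B.precedes_of_lt (Nat.lt_add_left i hj)
  exact FU_subset_FU (h𝒜 (le_depth_approx hBA n))
    (h _ (approx_mem_finBelow le_rfl n) (approx_mem_finBelow hBA n) hafter)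

end Diagonalization

/-! ### Matet-adequate families are selective coideals -/

namespace IsMatetAdequate

variable {H : Set FINInf} {A : FINInf} {a : FINFin}

theorem exists_homogeneous (hH : IsMatetAdequate H) (hA : A ∈ H) (p : FIN → Prop) :
    ∃ B ∈ H, B ≤ A ∧ ((∀ t ∈ FU B.blocks, p t) ∨ ∀ t ∈ FU B.blocks, ¬ p t) := by
  obtain ⟨B, hB, hBA, hp⟩ := hH.hindman A hA (FU A.blocks ∩ {t | p t}) (FU A.blocks \ {t | p t})
    (Set.inter_union_sdiff _ _) disjoint_inf_sdiff
  exact ⟨B, hB, hBA, hp.imp (fun h t ht => (h ht).2) fun h t ht => (h ht).2⟩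

theorem exists_precedesBy (hH : IsMatetAdequate H) (hA : A ∈ H) (F : ℕ → ℕ) :
    ∃ B ∈ H, B ≤ A ∧ ∀ i j, i < j → PrecedesBy F (B.block i) (B.block j) := by
  obtain ⟨B, hB, hBA, heven | hodd⟩ :=
    hH.exists_homogeneous hA fun t => Even (shortGaps F t.1).card
  · exact ⟨B, hB, hBA, fun _ _ => precedesBy_block_of_forall_even heven⟩
  · obtain ⟨t, ht, heven⟩ := exists_even_card_shortGaps F B
    exact absurd heven (hodd t ht)

theorem exists_forall_block_mem (hH : IsMatetAdequate H) {𝒜 : ℕ → FINInf} (h𝒜 : ∀ n, 𝒜 n ∈ H)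
    (hanti : Antitone 𝒜) (ha : ∀ n, a ∈ finBelow (𝒜 n)) :
    ∃ B ∈ H, approx a.length B = a ∧ ∀ n, B.block n ∈ FU (𝒜 (approx n B).bound).blocks := by
  obtain ⟨C, hC, hC𝒜⟩ := hH.sigma_closed 𝒜 h𝒜 fun n =>
    almostLE_iff_exists_drop_le.2 ⟨0, (FINInf.drop_le 0 _).trans (hanti n.le_succ)⟩
  choose g hg using fun n => (hC𝒜 n).exists_forall_mem_FU
  obtain ⟨D, hD, hDC, hgap⟩ := hH.exists_precedesBy hC fun x => g (x + 1)
  have hB : a.append (D.drop (g a.bound)) ∈ H :=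
    hH.finite_changes.append_mem (hH.finite_changes.drop_mem hD _) a
  refine ⟨_, hB, a.approx_length_append _, fun n => ?_⟩
  rcases lt_or_ge n a.length with hn | hn
  · rw [FINFin.append_block_of_lt _ hn]
    exact ha _ (List.getElem_mem hn)
  obtain ⟨i, rfl⟩ := Nat.exists_eq_add_of_le hn
  rcases i with _ | i
  · rw [FINFin.append_block_length_add, Nat.add_zero, a.approx_length_append]
    refine hg _ _ (hDC (D.block_mem _)) fun x hx => ?_
    exact (Nat.le_add_left _ _).trans (D.le_of_mem_block hx)
  · rw [← Nat.add_assoc, bound_approx_succ, Nat.add_assoc]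
    simp only [FINFin.append_block_length_add]
    refine hg _ _ (hDC (D.block_mem _)) fun x hx => ?_
    exact ((hgap _ _ (by omega)).trans_le (Finset.min'_le _ x hx)).le

theorem isCoideal (hH : IsMatetAdequate H) : IsCoideal H where
  finite_changes := hH.finite_changes
  upwards := hH.upwards
  amalgamation_nonempty _ _ _ ha _ hB :=
    nbhd_nonempty_iff.2 (mem_finBelow_of_mem_nbhd_depth ha hB.1)
  amalgamation_subset A _ a ha B hB hBA hne := by
    have hA' := append_mem_nbhd (approx_mem_finBelow le_rfl (depth A a)) hBA
    refine ⟨_, ⟨hA', hH.finite_changes.append_mem hB _⟩,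
      nbhd_nonempty_iff.2 (mem_finBelow_of_mem_nbhd_depth ha hA'), fun C hC => ⟨hC.1, ?_⟩⟩
    rintro _ ⟨i, rfl⟩
    rcases lt_or_ge i a.length with hi | hi
    · exact nbhd_nonempty_iff.1 hne (block_mem_of_mem_nbhd hC hi)
    · exact block_mem_FU_of_mem_nbhd_append ha hC hi
  pigeonhole A hA a ha O _ := by
    obtain ⟨B, hB, hBA, hp⟩ := hH.exists_homogeneous hA fun t => ∃ o ∈ O, o.list = a.list ++ [t]
    refine ⟨_, ⟨append_mem_nbhd (approx_mem_finBelow le_rfl (depth A a)) hBA,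
      hH.finite_changes.append_mem hB _⟩, ?_⟩
    refine hp.imp (fun hO => ?_) fun hO => Set.eq_empty_of_forall_notMem ?_
    · rintro _ ⟨C, hC, rfl⟩
      obtain ⟨o, ho, hoC⟩ := hO _ (block_mem_FU_of_mem_nbhd_append ha hC le_rfl)
      rwa [FINFin.ext ((list_approx_succ_of_mem_nbhd hC).trans hoC.symm)]
    · rintro _ ⟨⟨C, hC, rfl⟩, hCO⟩
      exact hO _ (block_mem_FU_of_mem_nbhd_append ha hC le_rfl)
        ⟨_, hCO, list_approx_succ_of_mem_nbhd hC⟩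

theorem isSelectiveCoideal (hH : IsMatetAdequate H) : IsSelectiveCoideal H where
  toIsCoideal := hH.isCoideal
  selective a A _ _ 𝒜 h𝒜 hanti ha := by
    have hanti : Antitone 𝒜 := antitone_nat_of_succ_le hanti
    obtain ⟨B, hB, haB, hmem⟩ := hH.exists_forall_block_mem (fun n => (h𝒜 n).1) hanti
      fun n => nbhd_nonempty_iff.1 (ha n)
    have hBA : B ≤ A := by
      rintro _ ⟨n, rfl⟩
      exact FU_subset_FU (h𝒜 _).2 (hmem n)
    exact ⟨B, ⟨hB, mem_nbhd_iff.2 ⟨haB, hBA⟩⟩, diagonalizes_of_forall_block_mem hanti hmem⟩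

end IsMatetAdequate

/-! ### Selective coideals are Matet-adequate -/

/-- The empty block sequence. -/
instance : EmptyCollection FINFin := ⟨⟨[], List.Pairwise.nil⟩⟩

theorem FINFin.empty_mem_finBelow (A : FINInf) : (∅ : FINFin) ∈ finBelow A := fun _ hs =>
  absurd hs List.not_mem_nil

/-- The block sequence with the single block `s`. -/
def FINFin.single (s : FIN) : FINFin := ⟨[s], List.pairwise_singleton _ _⟩

theorem FINFin.single_injective : Function.Injective FINFin.single := fun _ _ h =>
  List.singleton_injective (congrArg FINFin.list h)

theorem single_mem_approx_one_image_nbhd {B : FINInf} {t : FIN} (ht : t ∈ FU B.blocks) :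
    FINFin.single t ∈ approx 1 '' nbhd ∅ B := by
  have hbelow : FINFin.single t ∈ finBelow B := fun s hs => List.mem_singleton.1 hs ▸ ht
  obtain ⟨C, hC⟩ := nbhd_nonempty_iff.2 hbelow
  exact ⟨C, ⟨⟨0, rfl⟩, hC.2⟩, (mem_nbhd_iff.1 hC).1⟩

theorem IsCoideal.hindman {H : Set FINInf} (hH : IsCoideal H) {A : FINInf} (hA : A ∈ H)
    {P Q : Set FIN} (hPQ : P ∪ Q = FU A.blocks) :
    ∃ B ∈ H, B ≤ A ∧ (FU B.blocks ⊆ P ∨ FU B.blocks ⊆ Q) := by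
  obtain ⟨B, ⟨⟨-, hBA⟩, hB⟩, hO⟩ := hH.pigeonhole A hA ∅ (FINFin.empty_mem_finBelow A)
    (FINFin.single '' P) (Set.forall_mem_image.2 fun _ _ => rfl)
  refine ⟨B, hB, hBA, hO.imp (fun hO t ht => ?_) fun hO t ht => ?_⟩
  · exact FINFin.single_injective.mem_set_image.1 (hO (single_mem_approx_one_image_nbhd ht))
  · have htPQ : t ∈ P ∪ Q := hPQ ▸ FU_subset_FU hBA ht
    refine htPQ.resolve_left fun htP => ?_
    exact Set.eq_empty_iff_forall_notMem.1 hO _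
      ⟨single_mem_approx_one_image_nbhd ht, Set.mem_image_of_mem _ htP⟩

theorem IsSelectiveCoideal.exists_forall_almostLE {H : Set FINInf} (hH : IsSelectiveCoideal H)
    {𝒜 : ℕ → FINInf} (h𝒜 : ∀ n, 𝒜 n ∈ H) (hle : ∀ n, AlmostLE (𝒜 (n + 1)) (𝒜 n)) :
    ∃ B ∈ H, ∀ n, AlmostLE B (𝒜 n) := by
  obtain ⟨k, hanti⟩ := exists_antitone_drop hle
  have hdrop : ∀ n, (𝒜 n).drop (k n) ∈ H ∧ (𝒜 n).drop (k n) ≤ 𝒜 0 := fun n =>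
    ⟨hH.finite_changes.drop_mem (h𝒜 n) _, (hanti n.zero_le).trans (FINInf.drop_le _ _)⟩
  have hempty : ∀ A : FINInf, (nbhd ∅ A).Nonempty := fun A =>
    nbhd_nonempty_iff.2 (FINFin.empty_mem_finBelow A)
  obtain ⟨B, ⟨hB, -, hBA⟩, hdiag⟩ := hH.selective ∅ (𝒜 0) (h𝒜 0) (hempty _) _ hdrop
    (fun n => hanti n.le_succ) fun _ => hempty _
  refine ⟨B, hB, fun n => almostLE_iff_exists_drop_le.2 ⟨n, ?_⟩⟩
  exact (hdiag.drop_le hBA hanti n).trans (FINInf.drop_le _ _)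

theorem IsSelectiveCoideal.isMatetAdequate {H : Set FINInf} (hH : IsSelectiveCoideal H) :
    IsMatetAdequate H where
  finite_changes := hH.finite_changes
  upwards := hH.upwards
  sigma_closed _ h𝒜 hle := hH.exists_forall_almostLE h𝒜 hle
  hindman _ hA _ _ hPQ _ := hH.toIsCoideal.hindman hA hPQ

end BlockSeq

theorem mainTheorem3 (H : Set BlockSeq.FINInf) :
    BlockSeq.IsMatetAdequate H ↔ BlockSeq.IsSelectiveCoideal H :=
  ⟨fun h => h.isSelectiveCoideal, fun h => h.isMatetAdequate⟩
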